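/- Let $d\ge 1$, let $\mathbb B=\{w\in\mathbb R^d:\|w\|\le 1\}$ be the Euclidean unit ball, and let $\mathcal W=\{x\mapsto\langle x,w\rangle : w\in\mathbb B\}$. For a probability distribution $D$ over $\mathbb R^d\times\{\pm1\}$ with marginal $D_X$ on $\mathbb R^d$, for $h:\mathbb R^d\to\mathbb R$ and $\gamma\ge 0$, let $\ell_\gamma(h,D)=\mathbb P_{(X,Y)\sim D}[Y h(X)\le\gamma]$ and $\ell^*_\gamma(D)=\inf_{h\in\mathcal W}\ell_\gamma(h,D)$. For a sample $S=((x_i,y_i))_{i=1}^m$ let $\ell_\gamma(h,S)=\frac1m|\{i: y_i h(x_i)\le\gamma\}|$. A learning algorithm is a function $A$ from $\bigcup_{m\ge1}(\mathbb R^d\times\{\pm1\})^m$ to the real-valued functions on $\mathbb R^d$; for $\delta\in(0,1)$ put $$\ell_0(A,D,m,\delta)=\inf\{\epsilon\ge0 : \mathbb P_{S\sim D^m}[\ell_0(A(S),D)\ge\epsilon]\le\delta\}.$$ A margin-error minimization (MEM) algorithm maps each $\gamma>0$ to a learning algorithm $A_\gamma$ such that $A_\gamma(S)\in\operatorname{argmin}_{h\in\mathcal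 W}\ell_\gamma(h,S)$ for every sample $S$. The sample complexity $m(\epsilon,\gamma,D,\delta)$ is the smallest $n\ge1$ such that $\ell_0(A_\gamma,D,m,\delta)-\ell^*_\gamma(D)\le\epsilon$ for every MEM algorithm $A$ and every $m\ge n$ (and $\infty$ if there is no such $n$). A real random variable $Z$ is sub-Gaussian with relative moment $\rho>0$ if $\mathbb E[\exp(tZ)]\le\exp(t^2\rho^2\,\mathbb E[Z^2]/2)$ for all $t\in\mathbb R$. A random vector $X\in\mathbb R^d$ is sub-Gaussian if there is a symmetric positive semidefinite matrix $B$ with $\mathbb E[\exp(\langle u,X\rangle)]\le\exp(\langle Bu,u\rangle/2)$ for all $u\in\mathbb R^d$. **Theorem.** There are absolute constants $\beta>0$ and $C\ge0$ such that for every integer $d>1$ there exist two probability distributions $D$ and $P$ over $\mathbb R^d\times\{\pm1\}$ such that: 1. $D_X$ and $P_X$ have identical covariance matrices; 2. $D_X$ and $P_X$ are laws of sub-Gaussian random vectors, and for every $u\in\mathbb R^d$ the variable $\langle u,X\rangle$ is sub-Gaussian with relative moment $\sqrt2$, both for $X\sim D_X$ and for $X\sim P_X$; 3. for all $\epsilon,\delta\in(0,\frac14)$,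 $$m(\epsilon,1,P,\delta)\ge\beta d-C \qquad\text{and}\qquad m(\epsilon,1,D,\delta)\le\lceil\log_2(1/\delta)\rceil .$$ -/

import Mathlib

open MeasureTheory ProbabilityTheory
open scoped ENNReal

noncomputable section

namespace MarginLearning

/-- The label set `{±1}`, realised as the units of `ℤ`. -/
abbrev Label : Type := ℤˣ

/-- A label as a real number. -/
def Label.toReal (y : Label) : ℝ := ((y : ℤ) : ℝ)

/-- The `γ`-margin error `ℙ_{(X,Y) ∼ D}[Y · h(X) ≤ γ]` of `h` on the distribution `D`.
For `γ = 0` it is the misclassification error. -/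
def marginLoss {X : Type*} [MeasurableSpace X] (γ : ℝ) (h : X → ℝ)
    (D : Measure (X × Label)) : ℝ :=
  D.real {z | Label.toReal z.2 * h z.1 ≤ γ}

/-- The best achievable `γ`-margin error on `D` over the hypothesis class `H`. -/
def bestMarginLoss {X : Type*} [MeasurableSpace X] (γ : ℝ) (H : Set (X → ℝ))
    (D : Measure (X × Label)) : ℝ :=
  sInf ((fun h => marginLoss γ h D) '' H)

/-- The `γ`-margin error of `h` on a labeled sample of size `m`. -/
def empiricalMarginLoss {X : Type*} {m : ℕ} (γ : ℝ) (h : X → ℝ)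
    (S : Fin m → X × Label) : ℝ :=
  (1 / (m : ℝ)) * (({i | Label.toReal (S i).2 * h (S i).1 ≤ γ} : Set (Fin m)).ncard : ℝ)

/-- A learning algorithm maps labeled samples to real valued functions on the domain.
Only its values on nonempty samples are ever used below. -/
abbrev LearningAlgorithm (X : Type*) : Type _ :=
  (m : ℕ) → (Fin m → X × Label) → (X → ℝ)

/-- The high-probability loss
`inf {ε ≥ 0 | ℙ_{S ∼ D^m}[ℓ₀(A(S), D) ≥ ε] ≤ δ}` of a learning algorithm. -/
def highProbLoss {X : Type*} [MeasurableSpace X] (A : LearningAlgorithm X)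
    (D : Measure (X × Label)) (m : ℕ) (δ : ℝ) : ℝ :=
  sInf {ε : ℝ | 0 ≤ ε ∧
    (Measure.pi (fun _ : Fin m => D)).real {S | ε ≤ marginLoss 0 (A m S) D} ≤ δ}

/-- `A` is a margin-error minimization (MEM) algorithm for the class `H`: for every margin
`γ > 0` and every nonempty sample `S`, the output `A γ S` is in `H` and minimizes the
`γ`-margin error on `S` over `H`. -/
def IsMEM {X : Type*} (H : Set (X → ℝ)) (A : ℝ → LearningAlgorithm X) : Prop :=
  ∀ γ : ℝ, 0 < γ → ∀ m : ℕ, 1 ≤ m → ∀ S : Fin m → X × Label,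
    A γ m S ∈ H ∧
      ∀ h ∈ H, empiricalMarginLoss γ (A γ m S) S ≤ empiricalMarginLoss γ h S

/-- The distribution-specific sample complexity `m(ε, γ, D, δ)` of MEM for the class `H`: the
least sample size `n ≥ 1` such that every MEM algorithm has high-probability excess loss at
most `ε` for all sample sizes `m ≥ n` (and `⊤` if there is no such `n`). -/
def sampleComplexity {X : Type*} [MeasurableSpace X] (H : Set (X → ℝ))
    (ε γ : ℝ) (D : Measure (X × Label)) (δ : ℝ) : ℕ∞ :=
  sInf ((fun n : ℕ => (n : ℕ∞)) '' {n : ℕ | 1 ≤ n ∧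
    ∀ A : ℝ → LearningAlgorithm X, IsMEM H A → ∀ m : ℕ, n ≤ m →
      highProbLoss (A γ) D m δ - bestMarginLoss γ H D ≤ ε})

/-- The class of homogeneous linear separators `x ↦ ⟨x, w⟩` with `‖w‖ ≤ 1`. -/
def linearClass (d : ℕ) : Set (EuclideanSpace ℝ (Fin d) → ℝ) :=
  {h | ∃ w : EuclideanSpace ℝ (Fin d), ‖w‖ ≤ 1 ∧ h = fun x => inner ℝ x w}

/-- The covariance matrix of a distribution over `ℝ^d`. -/
def covarianceMatrix {d : ℕ} (μ : Measure (EuclideanSpace ℝ (Fin d))) :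
    Matrix (Fin d) (Fin d) ℝ :=
  Matrix.of fun i j => cov[fun x => x i, fun x => x j; μ]

/-- `Z` is sub-Gaussian with moment `B ≥ 0`: for all real `t`, `exp (t Z)` is integrable and
`𝔼[exp (t Z)] ≤ exp (t² B² / 2)`. -/
def IsSubGaussian {Ω : Type*} [MeasurableSpace Ω] (μ : Measure Ω) (Z : Ω → ℝ) (B : ℝ) : Prop :=
  0 ≤ B ∧ ∀ t : ℝ, Integrable (fun ω => Real.exp (t * Z ω)) μ ∧
    ∫ ω, Real.exp (t * Z ω) ∂μ ≤ Real.exp (t ^ 2 * B ^ 2 / 2)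

/-- `Z` is sub-Gaussian with relative moment `ρ > 0`, i.e. with moment `ρ √(𝔼[Z²])`. -/
def HasRelativeMoment {Ω : Type*} [MeasurableSpace Ω] (μ : Measure Ω) (Z : Ω → ℝ)
    (ρ : ℝ) : Prop :=
  0 < ρ ∧ IsSubGaussian μ Z (ρ * Real.sqrt (∫ ω, Z ω ^ 2 ∂μ))

/-- `μ` is the law of a sub-Gaussian random vector with (symmetric positive semidefinite)
moment matrix `B`. -/
def IsSubGaussianVector {d : ℕ} (μ : Measure (EuclideanSpace ℝ (Fin d)))
    (B : Matrix (Fin d) (Fin d) ℝ) : Prop :=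
  B.PosSemidef ∧ ∀ u : EuclideanSpace ℝ (Fin d),
    Integrable (fun x => Real.exp (inner ℝ u x)) μ ∧
      ∫ x, Real.exp (inner ℝ u x) ∂μ ≤ Real.exp (inner ℝ (Matrix.toEuclideanLin B u) u / 2)

end MarginLearning

end

/-!
In both distributions the label is the sign of the coordinate `0` of a random vertex of a box. The
half-side along coordinate `0` is a number `a > 1`, so the separator along that axis has margin `a`
and no error.

Under `P` all other half-sides equal some `b`, and a separator ignoring coordinate `0` is right with
probability at most `1/2`. The products of the label with the signs of the other `k = d - 1`
coordinates form a uniform sign vector, and fewer than `k` such vectors are linearly independent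
with probability at least `1/2`: a subspace of dimension `i` contains at most `2^i` sign vectors.
If they are independent, some linear functional equals `1` on all of them, so for large `b` a
separator that ignores coordinate `0` fits the sample with margin `1`, and an MEM algorithm may
return it.

Under `D` the other half-sides are `√2 b` or `0` with equal probability, which preserves the second
moments. A single example of the second kind forces every `w` fitting the sample to satisfy
`a * w 0 > 1`. If `a` is close to `1`, such a `w` is so close to the axis that it makes no error.
Hence failure requires all `m` examples to be of the first kind, which has probability `2^(-m)`.
-/

noncomputable section

namespace MarginLearning

open Filter
open scoped BigOperators

section RealInequalities

lemma half_pow_le_of_logb_le {δ : ℝ} (hδ : 0 < δ) {m : ℕ} (hm : Real.logb 2 (1 / δ) ≤ m) :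
    (1 / 2 : ℝ) ^ m ≤ δ := by
  rw [Real.logb_le_iff_le_rpow one_lt_two (by positivity), Real.rpow_natCast] at hm
  rw [one_div_pow]
  exact (one_div_le hδ (by positivity)).1 hm

lemma exists_one_lt_sq_sub_one_mul_le {K : ℝ} (hK : 0 ≤ K) :
    ∃ a : ℝ, 1 < a ∧ (a ^ 2 - 1) * K ≤ 1 := by
  have hpos : 0 < (K + 1)⁻¹ := by positivity
  refine ⟨√(1 + (K + 1)⁻¹), Real.lt_sqrt_of_sq_lt (by linarith), ?_⟩
  rw [Real.sq_sqrt (by positivity), add_sub_cancel_left, inv_mul_le_iff₀ (by positivity)]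
  linarith

end RealInequalities

section Label

instance : DiscreteMeasurableSpace Label where
  forall_measurableSet s :=
    ⟨Units.val '' s, DiscreteMeasurableSpace.forall_measurableSet _,
      Set.preimage_image_eq s Units.val_injective⟩

lemma Label.toReal_one : Label.toReal 1 = 1 := by
  simp [Label.toReal]

lemma Label.toReal_neg (y : Label) : Label.toReal (-y) = -Label.toReal y := by
  simp [Label.toReal]

lemma Label.toReal_mul (y z : Label) :
    Label.toReal (y * z) = Label.toReal y * Label.toReal z := by
  simp [Label.toReal]

lemma Label.toReal_mul_self (y : Label) : Label.toReal y * Label.toReal y = 1 := by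
  rw [← Label.toReal_mul, Int.units_mul_self, Label.toReal_one]

lemma Label.toReal_sq (y : Label) : Label.toReal y ^ 2 = 1 := by
  rw [sq, Label.toReal_mul_self]

lemma Label.toReal_injective : Function.Injective Label.toReal :=
  Int.cast_injective.comp Units.val_injective

lemma Label.sum_exp_mul_toReal (u : ℝ) :
    ∑ y : Label, Real.exp (u * Label.toReal y) = 2 * Real.cosh u := by
  have huniv : (Finset.univ : Finset Label) = {1, -1} := by decide
  rw [huniv, Finset.sum_pair (by decide), Label.toReal_neg, Label.toReal_one, mul_one, mul_neg_one,
    Real.cosh_eq]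
  ring

end Label

section Uniform

lemma expect_eq_zero_of_antisymm {Ω : Type*} [Fintype Ω] {f : Ω → ℝ} (e : Equiv.Perm Ω)
    (hf : ∀ ω, f (e ω) = -f ω) : 𝔼 ω, f ω = 0 := by
  refine self_eq_neg.1 ?_
  rw [← Finset.expect_neg_distrib]
  exact (Fintype.expect_equiv e _ _ fun ω => (hf ω).symm).symm

variable {Ω : Type*} [MeasurableSpace Ω] [DiscreteMeasurableSpace Ω]

lemma uniformOn_univ_real [Finite Ω] (s : Set Ω) :
    (uniformOn (Set.univ : Set Ω)).real s = s.ncard / Nat.card Ω := by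
  have := Fintype.ofFinite Ω
  rw [measureReal_def, uniformOn_univ, ENNReal.toReal_div, Measure.count_apply (.of_discrete),
    ← s.toFinite.cast_ncard_eq, ENat.toENNReal_coe, ENNReal.toReal_natCast,
    ENNReal.toReal_natCast, Nat.card_eq_fintype_card]

lemma uniformOn_univ_real_preimage_fst_of_equiv_prod {α β : Type*} [Finite α] [Finite β]
    [Nonempty β] (e : Ω ≃ α × β) (s : Set α) :
    (uniformOn (Set.univ : Set Ω)).real {ω | (e ω).1 ∈ s} = s.ncard / Nat.card α := by
  have := Finite.of_equiv _ e.symm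
  have hcard : {ω | (e ω).1 ∈ s}.ncard = s.ncard * Nat.card β := by
    rw [← Set.ncard_univ, ← Set.ncard_prod, ← Set.ncard_image_of_injective _ e.symm.injective,
      e.image_symm_eq_preimage, Set.prod_univ]
    rfl
  have hβ : (Nat.card β : ℝ) ≠ 0 := Nat.cast_ne_zero.2 Nat.card_pos.ne'
  rw [uniformOn_univ_real, hcard, Nat.card_congr e, Nat.card_prod, Nat.cast_mul, Nat.cast_mul,
    mul_div_mul_right _ _ hβ]

lemma integral_uniformOn_univ [Fintype Ω] (f : Ω → ℝ) :
    ∫ ω, f ω ∂uniformOn (Set.univ : Set Ω) = 𝔼 ω, f ω := by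
  rw [integral_fintype .of_finite, Fintype.expect_eq_sum_div_card, Finset.sum_div]
  refine Finset.sum_congr rfl fun ω _ => ?_
  rw [uniformOn_univ_real, Set.ncard_singleton, Nat.cast_one, smul_eq_mul, one_div_mul_eq_div,
    Nat.card_eq_fintype_card]

lemma half_le_uniformOn_univ_nonpos_of_antisymm [Finite Ω] [Nonempty Ω] {f : Ω → ℝ}
    (e : Equiv.Perm Ω) (hf : ∀ ω, f (e ω) = -f ω) :
    1 / 2 ≤ (uniformOn (Set.univ : Set Ω)).real {ω | f ω ≤ 0} := by
  set μ := uniformOn (Set.univ : Set Ω)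
  have hle : μ.real {ω | f ω ≤ 0}ᶜ ≤ μ.real {ω | f ω ≤ 0} := by
    simp only [μ, uniformOn_univ_real]
    refine div_le_div_of_nonneg_right (Nat.cast_le.2 ?_) (Nat.cast_nonneg _)
    refine Set.ncard_le_ncard_of_injOn e (fun ω (hω : ¬f ω ≤ 0) => ?_) e.injective.injOn
      (Set.toFinite _)
    rw [Set.mem_ofPred_eq, hf]
    exact (neg_lt_zero.2 (not_le.1 hω)).le
  rw [probReal_compl_eq_one_sub .of_discrete] at hle
  linarith

lemma measure_pi_forall_fst_eq {T F : Type*} [Finite T] [Finite F] [Nonempty F]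
    [MeasurableSpace T] [MeasurableSpace F] [DiscreteMeasurableSpace T]
    [DiscreteMeasurableSpace F] (t : T) (m : ℕ) :
    (Measure.pi fun _ : Fin m => uniformOn (Set.univ : Set (T × F))).real
      {ω | ∀ i, (ω i).1 = t} = (1 / Nat.card T) ^ m := by
  have hpi : {ω : Fin m → T × F | ∀ i, (ω i).1 = t} =
      Set.univ.pi fun _ => {q | q.1 ∈ ({t} : Set T)} := by
    ext; simp
  have hone := uniformOn_univ_real_preimage_fst_of_equiv_prod (Equiv.refl (T × F)) {t}
  rw [Set.ncard_singleton, Nat.cast_one] at hone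
  rw [hpi, measureReal_def, Measure.pi_pi, ENNReal.toReal_prod]
  exact (Finset.prod_congr rfl fun i _ => hone).trans (by simp)

end Uniform

section Pushforward

variable {Ω Z : Type*} [MeasurableSpace Ω] [DiscreteMeasurableSpace Ω] [Countable Ω]
  [MeasurableSpace Z] [MeasurableSingletonClass Z]

/- Learning algorithms need not be measurable, so neither are the events they define: on a countable
probability space this is harmless. -/
lemma map_apply_of_countable (μ : Measure Ω) (f : Ω → Z) (s : Set Z) :
    μ.map f s = μ (f ⁻¹' s) := by
  have hf : AEMeasurable f μ := Measurable.of_discrete.aemeasurable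
  refine le_antisymm ?_ (Measure.le_map_apply hf s)
  have hrange : ∀ᵐ z ∂μ.map f, z ∈ Set.range f :=
    (ae_map_iff (p := (· ∈ Set.range f)) hf (Set.countable_range f).measurableSet).2
      (ae_of_all _ Set.mem_range_self)
  calc μ.map f s ≤ μ.map f (s ∩ Set.range f) :=
        measure_mono_ae (by filter_upwards [hrange] with z hz hs using ⟨hs, hz⟩)
    _ = μ (f ⁻¹' s) := by
        rw [Measure.map_apply_of_aemeasurable hf
          ((Set.countable_range f).mono Set.inter_subset_right).measurableSet,
          Set.preimage_inter_range]

lemma pi_map_real_of_countable {ι : Type*} [Fintype ι] (μ : Measure Ω) [IsProbabilityMeasure μ]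
    (f : Ω → Z) (s : Set (ι → Z)) :
    (Measure.pi fun _ : ι => μ.map f).real s =
      (Measure.pi fun _ : ι => μ).real {ω | f ∘ ω ∈ s} := by
  have hf : AEMeasurable f μ := Measurable.of_discrete.aemeasurable
  have : IsProbabilityMeasure (μ.map f) := Measure.isProbabilityMeasure_map hf
  rw [← Measure.pi_map_pi (μ := fun _ : ι => μ) fun _ => hf, measureReal_def,
    map_apply_of_countable]
  rfl

end Pushforward

section LinearIndependence

lemma exists_coords_determining {K ι : Type*} [Field K] [Finite ι] (V : Submodule K (ι → K)) :
    ∃ J : Finset ι, J.card ≤ Module.finrank K V ∧ ∀ x ∈ V, (∀ j ∈ J, x j = 0) → x = 0 := by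
  have := Fintype.ofFinite ι
  let coord : ι → Module.Dual K V := fun i => (LinearMap.proj i).comp V.subtype
  obtain ⟨κ, a, ha, hspan, hli⟩ := exists_linearIndependent' K coord
  have := Fintype.ofInjective a ha
  refine ⟨Finset.univ.map ⟨a, ha⟩, ?_, fun x hx hzero => funext fun i => ?_⟩
  · rw [Finset.card_map, Finset.card_univ, ← Subspace.dual_finrank_eq]
    exact hli.fintype_card_le_finrank
  · have hle : Submodule.span K (Set.range coord) ≤
        LinearMap.ker (Module.Dual.eval K V ⟨x, hx⟩) := by
      rw [← hspan, Submodule.span_le]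
      rintro _ ⟨j, rfl⟩
      exact hzero (a j) (by simp)
    exact hle (Submodule.subset_span ⟨i, rfl⟩)

lemma exists_dotProduct_eq_one {K ι κ : Type*} [Field K] [Fintype κ]
    {v : ι → κ → K} (hv : LinearIndependent K v) : ∃ w : κ → K, ∀ i, w ⬝ᵥ v i = 1 := by
  classical
  obtain ⟨φ, hφ⟩ := Module.exists_dual_forall_apply_eq_one (linearIndepOn_univ_iff.2 hv)
  refine ⟨(dotProductEquiv K κ).symm φ, fun i => ?_⟩
  rw [← dotProductEquiv_apply_apply, LinearEquiv.apply_symm_apply, hφ i (Set.mem_univ i)]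

lemma ncard_comp_mem_submodule_le {K ι α : Type*} [Field K] [Finite ι] [Finite α] [Nonempty α]
    {g : α → K} (hg : Function.Injective g) (V : Submodule K (ι → K)) :
    {σ : ι → α | g ∘ σ ∈ V}.ncard ≤ Nat.card α ^ Module.finrank K V := by
  obtain ⟨J, hJcard, hJ⟩ := exists_coords_determining V
  have hinj : Set.InjOn J.restrict {σ : ι → α | g ∘ σ ∈ V} := by
    intro σ hσ τ hτ h
    have hzero := hJ _ (V.sub_mem hσ hτ) fun j hj =>
      sub_eq_zero.2 (congrArg g (congrFun h ⟨j, hj⟩))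
    exact hg.comp_left (sub_eq_zero.1 hzero)
  calc {σ : ι → α | g ∘ σ ∈ V}.ncard ≤ (Set.univ : Set (J → α)).ncard :=
        Set.ncard_le_ncard_of_injOn _ (fun _ _ => Set.mem_univ _) hinj
    _ = Nat.card α ^ J.card := by
        rw [Set.ncard_univ, Nat.card_fun, Nat.card_eq_finsetCard]
    _ ≤ Nat.card α ^ Module.finrank K V :=
        Nat.pow_le_pow_right Nat.card_pos hJcard

lemma measure_mem_span_range_le {K E Ω : Type*} [DivisionRing K] [AddCommGroup E] [Module K E]
    [MeasurableSpace Ω] {μ : Measure Ω} {f : Ω → E} {p : ℕ → ℝ≥0∞}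
    (hp : ∀ V : Submodule K E, Module.Finite K V → μ {ω | f ω ∈ V} ≤ p (Module.finrank K V))
    {m : ℕ} {v : Fin m → E} (hv : LinearIndependent K v) :
    μ {ω | f ω ∈ Submodule.span K (Set.range v)} ≤ p m := by
  have h := hp _ (Module.Finite.span_of_finite K (Set.finite_range v))
  rwa [finrank_span_eq_card hv, Fintype.card_fin] at h

lemma measure_prod_le_of_forall_section_le {α β : Type*} [MeasurableSpace α] [MeasurableSpace β]
    {μ : Measure α} [SFinite μ] {ν : Measure β} [IsProbabilityMeasure ν] {s : Set (α × β)}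
    (hs : MeasurableSet s) {c : ℝ≥0∞} (h : ∀ y, μ {x | (x, y) ∈ s} ≤ c) : μ.prod ν s ≤ c := by
  rw [Measure.prod_apply_symm hs]
  exact (lintegral_mono h).trans_eq (by simp)

lemma measure_pi_not_linearIndependent_le {K E Ω : Type*} [DivisionRing K] [AddCommGroup E]
    [Module K E] [MeasurableSpace Ω] [DiscreteMeasurableSpace Ω] [Countable Ω] (μ : Measure Ω)
    [IsProbabilityMeasure μ] (f : Ω → E) (p : ℕ → ℝ≥0∞)
    (hp : ∀ V : Submodule K E, Module.Finite K V → μ {ω | f ω ∈ V} ≤ p (Module.finrank K V))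
    (m : ℕ) :
    Measure.pi (fun _ : Fin m => μ) {ω | ¬LinearIndependent K fun i => f (ω i)} ≤
      ∑ i ∈ Finset.range m, p i := by
  induction m with
  | zero => simp
  | succ m ih =>
    let tailDependent : Set (Ω × (Fin m → Ω)) := {q | ¬LinearIndependent K fun i => f (q.2 i)}
    let headInSpan : Set (Ω × (Fin m → Ω)) := {q | LinearIndependent K (fun i => f (q.2 i)) ∧
      f q.1 ∈ Submodule.span K (Set.range fun i => f (q.2 i))}
    have hhead : ∀ ω : Fin m → Ω, μ {x | (x, ω) ∈ headInSpan} ≤ p m := by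
      intro ω
      by_cases hω : LinearIndependent K fun i => f (ω i)
      · exact (measure_mono fun x hx => hx.2).trans (measure_mem_span_range_le hp hω)
      · simp [headInSpan, hω]
    rw [← (measurePreserving_piFinSuccAbove (fun _ : Fin (m + 1) => μ) 0).symm.map_eq,
      MeasurableEquiv.map_apply]
    calc (μ.prod (Measure.pi fun _ : Fin m => μ)) _
        ≤ (μ.prod (Measure.pi fun _ : Fin m => μ)) (tailDependent ∪ headInSpan) := by
          refine measure_mono fun q hq => ?_
          by_contra hnot
          simp only [Set.mem_union, not_or] at hnot
          have htail : LinearIndependent K fun i => f (q.2 i) := not_not.1 hnot.1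
          exact hq (linearIndependent_finSucc.2 ⟨htail, fun hmem => hnot.2 ⟨htail, hmem⟩⟩)
      _ ≤ (∑ i ∈ Finset.range m, p i) + p m := by
          refine (measure_union_le _ _).trans (add_le_add ?_ ?_)
          · have : tailDependent = Set.univ ×ˢ {ω | ¬LinearIndependent K fun i => f (ω i)} := by
              ext; simp [tailDependent]
            rw [this, Measure.prod_prod, measure_univ, one_mul]
            exact ih
          · exact measure_prod_le_of_forall_section_le .of_discrete hhead
      _ = ∑ i ∈ Finset.range (m + 1), p i := (Finset.sum_range_succ p m).symm

end LinearIndependence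

section EmpiricalMargin

variable {X : Type*} {m : ℕ} {γ : ℝ} {H : Set (X → ℝ)}

/-- `h` attains a margin greater than `γ` on every example of the sample `S`, that is, it has
empirical `γ`-margin error `0`. -/
def FitsWithMargin (γ : ℝ) (h : X → ℝ) (S : Fin m → X × Label) : Prop :=
  ∀ i, γ < Label.toReal (S i).2 * h (S i).1

/-- The hypotheses of `H` that an MEM algorithm may return on the sample `S`. -/
def empiricalMinimizers (γ : ℝ) (H : Set (X → ℝ)) (S : Fin m → X × Label) : Set (X → ℝ) :=
  {g | g ∈ H ∧ ∀ h ∈ H, empiricalMarginLoss γ g S ≤ empiricalMarginLoss γ h S}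

lemma empiricalMarginLoss_nonneg (γ : ℝ) (h : X → ℝ) (S : Fin m → X × Label) :
    0 ≤ empiricalMarginLoss γ h S := by
  unfold empiricalMarginLoss
  positivity

lemma empiricalMarginLoss_eq_zero_iff {h : X → ℝ} {S : Fin m → X × Label} :
    empiricalMarginLoss γ h S = 0 ↔ FitsWithMargin γ h S := by
  obtain rfl | hm := eq_or_ne m 0
  · simp [empiricalMarginLoss, FitsWithMargin]
  have hm' : (1 / m : ℝ) ≠ 0 := by positivity
  rw [empiricalMarginLoss, mul_eq_zero_iff_left hm', Nat.cast_eq_zero,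
    Set.ncard_eq_zero (Set.toFinite _), Set.eq_empty_iff_forall_notMem]
  exact forall_congr' fun i => by rw [Set.mem_ofPred_eq, not_le]

lemma FitsWithMargin.mem_empiricalMinimizers {h : X → ℝ} {S : Fin m → X × Label} (hh : h ∈ H)
    (hfit : FitsWithMargin γ h S) : h ∈ empiricalMinimizers γ H S :=
  ⟨hh, fun g _ => (empiricalMarginLoss_eq_zero_iff.2 hfit).trans_le
    (empiricalMarginLoss_nonneg γ g S)⟩

lemma fitsWithMargin_of_mem_empiricalMinimizers {g h : X → ℝ} {S : Fin m → X × Label}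
    (hg : g ∈ empiricalMinimizers γ H S) (hh : h ∈ H) (hfit : FitsWithMargin γ h S) :
    FitsWithMargin γ g S :=
  empiricalMarginLoss_eq_zero_iff.1 <| le_antisymm
    ((hg.2 h hh).trans_eq (empiricalMarginLoss_eq_zero_iff.2 hfit))
    (empiricalMarginLoss_nonneg γ g S)

lemma empiricalMinimizers_nonempty (hH : H.Nonempty) (S : Fin m → X × Label) :
    (empiricalMinimizers γ H S).Nonempty := by
  let errors : (X → ℝ) → ℕ := fun h => {i | Label.toReal (S i).2 * h (S i).1 ≤ γ}.ncard
  obtain ⟨g, hg, hmin⟩ := exists_minimalFor_of_wellFoundedLT (· ∈ H) errors hH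
  refine ⟨g, hg, fun h hh => mul_le_mul_of_nonneg_left (Nat.cast_le.2 ?_) (by positivity)⟩
  exact (le_total (errors h) (errors g)).elim (hmin hh) id

lemma exists_isMEM_mem_of_empiricalMinimizers_inter_nonempty (hH : H.Nonempty)
    (G : Set (X → ℝ)) : ∃ A : ℝ → LearningAlgorithm X, IsMEM H A ∧
      ∀ (γ : ℝ) (m : ℕ) (S : Fin m → X × Label),
        (empiricalMinimizers γ H S ∩ G).Nonempty → A γ m S ∈ G := by
  have hchoice (γ : ℝ) (m : ℕ) (S : Fin m → X × Label) : ∃ g ∈ empiricalMinimizers γ H S,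
      (empiricalMinimizers γ H S ∩ G).Nonempty → g ∈ G := by
    by_cases hG : (empiricalMinimizers γ H S ∩ G).Nonempty
    · obtain ⟨g, hg, hgG⟩ := hG
      exact ⟨g, hg, fun _ => hgG⟩
    · obtain ⟨g, hg⟩ := empiricalMinimizers_nonempty (γ := γ) hH S
      exact ⟨g, hg, fun h => absurd h hG⟩
  choose A hA hAG using hchoice
  exact ⟨A, fun γ _ m _ S => hA γ m S, hAG⟩

end EmpiricalMargin

lemma linearClass_nonempty (d : ℕ) : (linearClass d).Nonempty :=
  ⟨_, 0, by simp, rfl⟩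

lemma inner_single_mem_linearClass {d : ℕ} (i : Fin d) :
    (fun x => inner ℝ x (EuclideanSpace.single i 1)) ∈ linearClass d :=
  ⟨_, by simp, rfl⟩

section SampleComplexity

variable {X : Type*} [MeasurableSpace X] {H : Set (X → ℝ)} {D : Measure (X × Label)}
  {γ ε δ η : ℝ} {m n : ℕ}

lemma bddBelow_marginLoss_image (γ : ℝ) (H : Set (X → ℝ)) (D : Measure (X × Label)) :
    BddBelow ((fun h => marginLoss γ h D) '' H) :=
  ⟨0, Set.forall_mem_image.2 fun _ _ => measureReal_nonneg⟩

lemma bestMarginLoss_nonneg (γ : ℝ) (H : Set (X → ℝ)) (D : Measure (X × Label)) :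
    0 ≤ bestMarginLoss γ H D :=
  Real.sInf_nonneg (Set.forall_mem_image.2 fun _ _ => measureReal_nonneg)

lemma bestMarginLoss_le {h : X → ℝ} (hh : h ∈ H) : bestMarginLoss γ H D ≤ marginLoss γ h D :=
  csInf_le (bddBelow_marginLoss_image γ H D) (Set.mem_image_of_mem _ hh)

lemma le_highProbLoss [IsProbabilityMeasure D] {A : LearningAlgorithm X} (hδ : 0 ≤ δ)
    (h : δ < (Measure.pi fun _ : Fin m => D).real {S | η ≤ marginLoss 0 (A m S) D}) :
    η ≤ highProbLoss A D m δ := by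
  refine le_csInf ⟨2, zero_le_two, ?_⟩ fun ε hε => ?_
  · have hempty : {S : Fin m → X × Label | 2 ≤ marginLoss 0 (A m S) D} = ∅ :=
      Set.eq_empty_of_forall_notMem fun S hS => by
        have h1 : marginLoss 0 (A m S) D ≤ 1 := measureReal_le_one
        linarith [show 2 ≤ marginLoss 0 (A m S) D from hS]
    rwa [hempty, measureReal_empty]
  · by_contra! hlt
    refine (h.trans_le ?_).not_ge hε.2
    exact measureReal_mono fun S hS => hlt.le.trans hS

lemma highProbLoss_nonpos [IsProbabilityMeasure D] {A : LearningAlgorithm X}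
    (h : (Measure.pi fun _ : Fin m => D).real {S | 0 < marginLoss 0 (A m S) D} ≤ δ) :
    highProbLoss A D m δ ≤ 0 := by
  refine le_of_forall_pos_le_add fun ε hε => ?_
  rw [zero_add]
  refine csInf_le ⟨0, fun _ hx => hx.1⟩ ⟨hε.le, le_trans ?_ h⟩
  exact measureReal_mono fun S hS => hε.trans_le hS

lemma lt_sampleComplexity_of_fitsWithMargin [IsProbabilityMeasure D] (hH : H.Nonempty)
    (hη : bestMarginLoss γ H D + ε < η) (hδ : 0 ≤ δ)
    (h : δ < (Measure.pi fun _ : Fin m => D).real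
      {S | ∃ g ∈ H, η ≤ marginLoss 0 g D ∧ FitsWithMargin γ g S}) :
    (m : ℕ∞) < sampleComplexity H ε γ D δ := by
  obtain ⟨A, hA, hAbad⟩ :=
    exists_isMEM_mem_of_empiricalMinimizers_inter_nonempty hH {g | η ≤ marginLoss 0 g D}
  have hloss : η ≤ highProbLoss (A γ) D m δ := by
    refine le_highProbLoss hδ (h.trans_le (measureReal_mono ?_))
    rintro S ⟨g, hg, hgη, hfit⟩
    exact hAbad γ m S ⟨g, hfit.mem_empiricalMinimizers hg, hgη⟩
  refine lt_of_lt_of_le (ENat.natCast_lt_natCast.2 m.lt_succ_self) (le_sInf ?_)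
  rintro _ ⟨n, ⟨-, hn⟩, rfl⟩
  rw [Nat.cast_le]
  by_contra! hlt
  linarith [hn A hA m (Nat.lt_succ_iff.1 hlt)]

lemma ae_fitsWithMargin [IsProbabilityMeasure D] {h : X → ℝ} (h0 : marginLoss γ h D = 0) (m : ℕ) :
    ∀ᵐ S ∂Measure.pi fun _ : Fin m => D, FitsWithMargin γ h S := by
  have hD : ∀ᵐ z ∂D, γ < Label.toReal z.2 * h z.1 := by
    simp only [ae_iff, not_lt]
    exact (measureReal_eq_zero_iff).1 h0
  exact ae_all_iff.2 fun i =>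
    (measurePreserving_eval (fun _ : Fin m => D) i).quasiMeasurePreserving.ae hD

lemma sampleComplexity_le_of_fitsWithMargin [IsProbabilityMeasure D] (hn : 1 ≤ n) (hγ : 0 < γ)
    (hε : 0 ≤ ε) {h : X → ℝ} (hh : h ∈ H) (h0 : marginLoss γ h D = 0)
    (hbad : ∀ m, n ≤ m → (Measure.pi fun _ : Fin m => D).real
      {S | ∃ g ∈ H, 0 < marginLoss 0 g D ∧ FitsWithMargin γ g S} ≤ δ) :
    sampleComplexity H ε γ D δ ≤ n := by
  refine sInf_le ⟨n, ⟨hn, fun A hA m hm => ?_⟩, rfl⟩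
  have hloss : highProbLoss (A γ) D m δ ≤ 0 := by
    refine highProbLoss_nonpos (le_trans ?_ (hbad m hm))
    refine ENNReal.toReal_mono (measure_ne_top _ _) (measure_mono_ae ?_)
    filter_upwards [ae_fitsWithMargin h0 m] with S hS hpos
    have hmin := hA γ hγ m (hn.trans hm) S
    exact ⟨A γ m S, hmin.1, hpos, fitsWithMargin_of_mem_empiricalMinimizers hmin hh hS⟩
  linarith [bestMarginLoss_nonneg γ H D]

end SampleComplexity

section RandomSigns

variable {ι : Type*} [Fintype ι] [DecidableEq ι]

lemma expect_toReal (i : ι) : 𝔼 σ : ι → Label, Label.toReal (σ i) = 0 :=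
  expect_eq_zero_of_antisymm (Equiv.neg _) fun σ => Label.toReal_neg (σ i)

lemma expect_toReal_mul_toReal (i j : ι) :
    𝔼 σ : ι → Label, Label.toReal (σ i) * Label.toReal (σ j) = if i = j then 1 else 0 := by
  split_ifs with hij
  · subst hij
    simp only [Label.toReal_mul_self]
    exact Fintype.expect_const 1
  · refine expect_eq_zero_of_antisymm (Equiv.mulLeft (Pi.mulSingle i (-1))) fun σ => ?_
    simp only [Equiv.coe_mulLeft, Pi.mul_apply, Pi.mulSingle_eq_same,
      Pi.mulSingle_eq_of_ne (Ne.symm hij), one_mul, Label.toReal_neg, neg_mul]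

lemma expect_sq_sum_mul_toReal (v : ι → ℝ) :
    𝔼 σ : ι → Label, (∑ i, v i * Label.toReal (σ i)) ^ 2 = ∑ i, v i ^ 2 := by
  simp only [sq, Finset.sum_mul_sum, mul_mul_mul_comm, Finset.expect_sum_comm,
    ← Finset.mul_expect, expect_toReal_mul_toReal, mul_ite, mul_one, mul_zero,
    Finset.sum_ite_eq, Finset.mem_univ, if_true]

lemma expect_exp_sum_mul_toReal (v : ι → ℝ) :
    𝔼 σ : ι → Label, Real.exp (∑ i, v i * Label.toReal (σ i)) = ∏ i, Real.cosh (v i) := by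
  have hcard : (Fintype.card (ι → Label) : ℝ) = ∏ _i : ι, 2 := by
    simp [Fintype.card_units_int]
  rw [Fintype.expect_eq_sum_div_card, hcard, div_eq_iff (by positivity),
    ← Finset.prod_mul_distrib]
  simp only [mul_comm _ (2 : ℝ), ← Label.sum_exp_mul_toReal, Real.exp_sum, Finset.prod_univ_sum,
    Fintype.piFinset_univ]

lemma expect_exp_sum_mul_toReal_le (v : ι → ℝ) :
    𝔼 σ : ι → Label, Real.exp (∑ i, v i * Label.toReal (σ i)) ≤
      Real.exp ((∑ i, v i ^ 2) / 2) := by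
  rw [expect_exp_sum_mul_toReal, Finset.sum_div, Real.exp_sum]
  exact Finset.prod_le_prod (fun i _ => (Real.cosh_pos _).le)
    fun i _ => Real.cosh_le_exp_half_sq (v i)

end RandomSigns

section BoxMixture

variable {T : Type*} {k : ℕ}

/-- The vertex with signs `σ` of the axis-parallel box with half-sides `c t`, where `ω = (t, σ)`,
labeled by the sign of its first coordinate. -/
def labeledVertex (c : T → Fin (k + 1) → ℝ) (ω : T × (Fin (k + 1) → Label)) :
    EuclideanSpace ℝ (Fin (k + 1)) × Label :=
  (WithLp.toLp 2 fun i => c ω.1 i * Label.toReal (ω.2 i), ω.2 0)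

/-- The balanced mixture over `t : T` of the uniform distributions on the labeled vertices of the
boxes with half-sides `c t`. -/
def boxMixture [MeasurableSpace T] (c : T → Fin (k + 1) → ℝ) :
    Measure (EuclideanSpace ℝ (Fin (k + 1)) × Label) :=
  (uniformOn (Set.univ : Set (T × (Fin (k + 1) → Label)))).map (labeledVertex c)

/-- The variance of each coordinate under `boxMixture c`. -/
def coordVariance [Fintype T] (c : T → Fin (k + 1) → ℝ) (i : Fin (k + 1)) : ℝ :=
  𝔼 t, c t i ^ 2

lemma inner_labeledVertex (c : T → Fin (k + 1) → ℝ) (u : EuclideanSpace ℝ (Fin (k + 1)))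
    (ω : T × (Fin (k + 1) → Label)) :
    inner ℝ u (labeledVertex c ω).1 = ∑ i, u i * c ω.1 i * Label.toReal (ω.2 i) := by
  rw [PiLp.inner_apply]
  refine Finset.sum_congr rfl fun i _ => ?_
  rw [RCLike.inner_apply, conj_trivial, labeledVertex, mul_comm, mul_assoc]

variable [MeasurableSpace T] [DiscreteMeasurableSpace T]

lemma boxMixture_fst [Countable T] (c : T → Fin (k + 1) → ℝ) :
    (boxMixture c).fst =
      (uniformOn Set.univ).map fun ω => (labeledVertex c ω).1 :=
  Measure.map_map measurable_fst .of_discrete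

instance isProbabilityMeasure_boxMixture [Finite T] [Nonempty T] (c : T → Fin (k + 1) → ℝ) :
    IsProbabilityMeasure (boxMixture c) :=
  Measure.isProbabilityMeasure_map Measurable.of_discrete.aemeasurable

lemma pi_boxMixture_real [Finite T] [Nonempty T] {m : ℕ} (c : T → Fin (k + 1) → ℝ)
    (s : Set (Fin m → EuclideanSpace ℝ (Fin (k + 1)) × Label)) :
    (Measure.pi fun _ : Fin m => boxMixture c).real s =
      (Measure.pi fun _ : Fin m => uniformOn Set.univ).real {ω | labeledVertex c ∘ ω ∈ s} :=
  pi_map_real_of_countable _ _ _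

lemma integrable_boxMixture_fst [Finite T] (c : T → Fin (k + 1) → ℝ)
    {f : EuclideanSpace ℝ (Fin (k + 1)) → ℝ} (hf : Measurable f) :
    Integrable f (boxMixture c).fst := by
  rw [boxMixture_fst, integrable_map_measure hf.aestronglyMeasurable
    Measurable.of_discrete.aemeasurable]
  exact .of_finite

lemma integral_boxMixture_fst [Fintype T] (c : T → Fin (k + 1) → ℝ)
    {f : EuclideanSpace ℝ (Fin (k + 1)) → ℝ} (hf : Measurable f) :
    ∫ x, f x ∂(boxMixture c).fst =
      𝔼 t, 𝔼 σ : Fin (k + 1) → Label, f (labeledVertex c (t, σ)).1 := by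
  rw [boxMixture_fst, integral_map Measurable.of_discrete.aemeasurable hf.aestronglyMeasurable,
    integral_uniformOn_univ, ← Finset.univ_product_univ, Finset.expect_product]

lemma covarianceMatrix_boxMixture_fst [Fintype T] (c : T → Fin (k + 1) → ℝ) :
    covarianceMatrix (boxMixture c).fst = Matrix.diagonal (coordVariance c) := by
  have hmean (i : Fin (k + 1)) : ∫ x, x i ∂(boxMixture c).fst = 0 := by
    rw [integral_boxMixture_fst c (by fun_prop)]
    simp only [labeledVertex, ← Finset.mul_expect, expect_toReal, mul_zero,
      Finset.expect_const_zero]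
  ext i j
  simp only [covarianceMatrix, Matrix.of_apply, covariance, hmean, sub_zero]
  rw [integral_boxMixture_fst c (by fun_prop), Matrix.diagonal_apply]
  simp only [labeledVertex, mul_mul_mul_comm, ← Finset.mul_expect, expect_toReal_mul_toReal]
  split_ifs with hij
  · simp only [hij, mul_one, ← sq, coordVariance]
  · simp only [mul_zero, Finset.expect_const_zero]

lemma integral_inner_sq_boxMixture_fst [Fintype T] (c : T → Fin (k + 1) → ℝ)
    (u : EuclideanSpace ℝ (Fin (k + 1))) :
    ∫ x, inner ℝ u x ^ 2 ∂(boxMixture c).fst = ∑ i, coordVariance c i * u i ^ 2 := by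
  rw [integral_boxMixture_fst c (by fun_prop)]
  simp only [inner_labeledVertex, expect_sq_sum_mul_toReal, Finset.expect_sum_comm, mul_pow,
    ← Finset.mul_expect, coordVariance]
  exact Finset.sum_congr rfl fun i _ => mul_comm _ _

lemma integral_exp_inner_boxMixture_fst_le [Finite T] [Nonempty T]
    {c : T → Fin (k + 1) → ℝ} {M : Fin (k + 1) → ℝ}
    (hM : ∀ t i, c t i ^ 2 ≤ M i) (u : EuclideanSpace ℝ (Fin (k + 1))) :
    ∫ x, Real.exp (inner ℝ u x) ∂(boxMixture c).fst ≤ Real.exp ((∑ i, M i * u i ^ 2) / 2) := by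
  have := Fintype.ofFinite T
  rw [integral_boxMixture_fst c (by fun_prop)]
  refine Finset.expect_le Finset.univ_nonempty fun t _ => ?_
  simp only [inner_labeledVertex]
  refine (expect_exp_sum_mul_toReal_le _).trans (Real.exp_le_exp.2 ?_)
  gcongr with i
  rw [mul_pow, mul_comm]
  exact mul_le_mul_of_nonneg_right (hM t i) (sq_nonneg _)

lemma isSubGaussianVector_boxMixture_fst [Finite T] [Nonempty T]
    {c : T → Fin (k + 1) → ℝ} {M : Fin (k + 1) → ℝ}
    (hM : ∀ t i, c t i ^ 2 ≤ M i) :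
    IsSubGaussianVector (boxMixture c).fst (Matrix.diagonal M) := by
  refine ⟨Matrix.PosSemidef.diagonal fun i => ?_, fun u => ⟨?_, ?_⟩⟩
  · exact (sq_nonneg _).trans (hM (Classical.arbitrary T) i)
  · exact integrable_boxMixture_fst c (by fun_prop)
  · refine (integral_exp_inner_boxMixture_fst_le hM u).trans_eq ?_
    congr 2
    rw [PiLp.inner_apply]
    refine Finset.sum_congr rfl fun i _ => ?_
    rw [RCLike.inner_apply, conj_trivial, Matrix.toLpLin_apply]
    simp only [Matrix.mulVec_diagonal]
    ring

lemma hasRelativeMoment_boxMixture_fst [Fintype T] [Nonempty T]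
    {c : T → Fin (k + 1) → ℝ} {ρ : ℝ} (hρ : 0 < ρ)
    (hc : ∀ t i, c t i ^ 2 ≤ ρ ^ 2 * coordVariance c i) (u : EuclideanSpace ℝ (Fin (k + 1))) :
    HasRelativeMoment (boxMixture c).fst (fun x => inner ℝ u x) ρ := by
  refine ⟨hρ, by positivity, fun s => ⟨integrable_boxMixture_fst c (by fun_prop), ?_⟩⟩
  simp only [← real_inner_smul_left]
  refine (integral_exp_inner_boxMixture_fst_le hc (s • u)).trans_eq ?_
  rw [mul_pow, Real.sq_sqrt (integral_nonneg fun x => sq_nonneg _),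
    integral_inner_sq_boxMixture_fst, Finset.mul_sum, Finset.mul_sum]
  congr 2
  refine Finset.sum_congr rfl fun i _ => ?_
  rw [PiLp.smul_apply, smul_eq_mul]
  ring

end BoxMixture

section RelativeSigns

variable {T : Type*} {k m : ℕ}

/-- The signs of the coordinates `1, …, k` multiplied by the label, i.e. by the sign of the
coordinate `0`. They are what a linear separator ignoring coordinate `0` has to fit. -/
def relativeSigns (σ : Fin (k + 1) → Label) : Fin k → Label :=
  fun j => σ 0 * σ j.succ

/-- The latent variable of `boxMixture` can be sampled by drawing its relative signs uniformly and
independently of the mixture component and the label. -/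
def relativeSignsEquiv (T : Type*) (k : ℕ) :
    T × (Fin (k + 1) → Label) ≃ (Fin k → Label) × T × Label where
  toFun ω := (relativeSigns ω.2, ω.1, ω.2 0)
  invFun q := (q.2.1, Fin.cons q.2.2 fun j => q.2.2 * q.1 j)
  left_inv ω := Prod.ext rfl <| funext <| Fin.cases rfl fun j => by
    simp [relativeSigns, ← mul_assoc, Int.units_mul_self]
  right_inv q := Prod.ext (funext fun j => by
    simp [relativeSigns, ← mul_assoc, Int.units_mul_self]) rfl

lemma toReal_mul_inner_labeledVertex (c : T → Fin (k + 1) → ℝ)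
    (w : EuclideanSpace ℝ (Fin (k + 1))) (ω : T × (Fin (k + 1) → Label)) :
    Label.toReal (labeledVertex c ω).2 * inner ℝ (labeledVertex c ω).1 w =
      c ω.1 0 * w 0 +
        ∑ j : Fin k, c ω.1 j.succ * Label.toReal (relativeSigns ω.2 j) * w j.succ := by
  rw [real_inner_comm, inner_labeledVertex, Fin.sum_univ_succ, mul_add, Finset.mul_sum]
  congr 1
  · rw [labeledVertex]
    linear_combination (c ω.1 0 * w 0) * Label.toReal_mul_self (ω.2 0)
  · refine Finset.sum_congr rfl fun j _ => ?_
    rw [relativeSigns, Label.toReal_mul, labeledVertex]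
    ring

lemma uniformOn_univ_relativeSigns_mem_submodule_le [Finite T] [Nonempty T] [MeasurableSpace T]
    [DiscreteMeasurableSpace T] (V : Submodule ℝ (Fin k → ℝ)) :
    (uniformOn (Set.univ : Set (T × (Fin (k + 1) → Label))))
        {ω | Label.toReal ∘ relativeSigns ω.2 ∈ V} ≤
      ENNReal.ofReal (2 ^ Module.finrank ℝ V / 2 ^ k) := by
  have hcard : Nat.card Label = 2 := by
    rw [Nat.card_eq_fintype_card, Fintype.card_units_int]
  rw [← ofReal_measureReal]
  refine ENNReal.ofReal_le_ofReal ?_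
  calc _ = (({τ : Fin k → Label | Label.toReal ∘ τ ∈ V}.ncard : ℝ)) / 2 ^ k := by
        refine (uniformOn_univ_real_preimage_fst_of_equiv_prod (relativeSignsEquiv T k)
          {τ | Label.toReal ∘ τ ∈ V}).trans ?_
        rw [Nat.card_fun, hcard, Nat.card_fin, Nat.cast_pow, Nat.cast_two]
    _ ≤ 2 ^ Module.finrank ℝ V / 2 ^ k := by
        have h := ncard_comp_mem_submodule_le Label.toReal_injective V
        rw [hcard] at h
        exact div_le_div_of_nonneg_right (by exact_mod_cast h) (by positivity)

lemma half_le_measure_pi_linearIndependent_relativeSigns [Finite T] [Nonempty T]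
    [MeasurableSpace T] [DiscreteMeasurableSpace T] (hm : m < k) :
    1 / 2 ≤ (Measure.pi fun _ : Fin m =>
      uniformOn (Set.univ : Set (T × (Fin (k + 1) → Label)))).real
        {ω | LinearIndependent ℝ fun i => Label.toReal ∘ relativeSigns (ω i).2} := by
  have hdep := measure_pi_not_linearIndependent_le
    (uniformOn (Set.univ : Set (T × (Fin (k + 1) → Label))))
    (fun ω => Label.toReal ∘ relativeSigns ω.2) (fun i => ENNReal.ofReal (2 ^ i / 2 ^ k))
    (fun V _ => uniformOn_univ_relativeSigns_mem_submodule_le V) m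
  have hsum : ∑ i ∈ Finset.range m, (2 : ℝ) ^ i / 2 ^ k ≤ 1 / 2 := by
    have hgeom : ∑ i ∈ Finset.range m, 2 ^ i < 2 ^ m :=
      Nat.geomSum_lt le_rfl fun i hi => Finset.mem_range.1 hi
    have hpow : 2 ^ m * 2 ≤ 2 ^ k := Nat.pow_le_pow_right two_pos hm
    rw [← Finset.sum_div, div_le_div_iff₀ (by positivity) two_pos, one_mul]
    exact_mod_cast (Nat.mul_le_mul_right 2 hgeom.le).trans hpow
  rw [← ENNReal.ofReal_sum_of_nonneg fun _ _ => by positivity] at hdep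
  have hcompl := ENNReal.toReal_le_of_le_ofReal (by norm_num)
    (hdep.trans (ENNReal.ofReal_le_ofReal hsum))
  rw [← measureReal_def, ← Set.compl_ofPred] at hcompl
  rw [probReal_compl_eq_one_sub (Set.to_countable _).measurableSet] at hcompl
  linarith

end RelativeSigns

section BoxMargins

variable {T : Type*} {k m : ℕ}

lemma half_le_marginLoss_boxMixture [Finite T] [Nonempty T] [MeasurableSpace T]
    [DiscreteMeasurableSpace T] (c : T → Fin (k + 1) → ℝ)
    {w : EuclideanSpace ℝ (Fin (k + 1))} (hw : w 0 = 0) :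
    1 / 2 ≤ marginLoss 0 (fun x => inner ℝ x w) (boxMixture c) := by
  rw [marginLoss, boxMixture, measureReal_def, map_apply_of_countable]
  refine half_le_uniformOn_univ_nonpos_of_antisymm
    (Equiv.prodCongr (Equiv.refl T) (Equiv.mulLeft (Pi.mulSingle 0 (-1)))) fun ω => ?_
  simp only [toReal_mul_inner_labeledVertex, hw, mul_zero, zero_add, ← Finset.sum_neg_distrib]
  refine Finset.sum_congr rfl fun j _ => ?_
  simp [relativeSigns, Label.toReal_neg]

lemma marginLoss_boxMixture_eq_zero [Finite T] [MeasurableSpace T] [DiscreteMeasurableSpace T]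
    {c : T → Fin (k + 1) → ℝ} {γ : ℝ} {h : EuclideanSpace ℝ (Fin (k + 1)) → ℝ}
    (hmargin : ∀ ω, γ < Label.toReal (labeledVertex c ω).2 * h (labeledVertex c ω).1) :
    marginLoss γ h (boxMixture c) = 0 := by
  rw [marginLoss, boxMixture, measureReal_def, map_apply_of_countable]
  simp [Set.preimage, (hmargin _).not_ge]

lemma marginLoss_single_boxMixture [Finite T] [MeasurableSpace T] [DiscreteMeasurableSpace T]
    {c : T → Fin (k + 1) → ℝ} {γ : ℝ} (hc : ∀ t, γ < c t 0) :
    marginLoss γ (fun x => inner ℝ x (EuclideanSpace.single 0 1)) (boxMixture c) = 0 := by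
  refine marginLoss_boxMixture_eq_zero fun ω => ?_
  simpa [toReal_mul_inner_labeledVertex] using hc ω.1

lemma inner_pos_of_one_lt_mul {z w : EuclideanSpace ℝ (Fin (k + 1))} (hw : ‖w‖ ≤ 1)
    (hzw : 1 < z 0 * w 0) (hz : (z 0 ^ 2 - 1) * ∑ j : Fin k, z j.succ ^ 2 ≤ 1) :
    0 < inner ℝ z w := by
  set Z := ∑ j : Fin k, z j.succ ^ 2
  set W := ∑ j : Fin k, w j.succ ^ 2
  have hZ : 0 ≤ Z := Finset.sum_nonneg fun _ _ => sq_nonneg _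
  have hW : 0 ≤ W := Finset.sum_nonneg fun _ _ => sq_nonneg _
  have hnorm : w 0 ^ 2 + W ≤ 1 := by
    rw [← Fin.sum_univ_succ fun i => w i ^ 2, ← EuclideanSpace.real_norm_sq_eq]
    exact pow_le_one₀ (norm_nonneg w) hw
  have hsq : 1 < z 0 ^ 2 * w 0 ^ 2 := by
    rw [← mul_pow]
    exact one_lt_pow₀ hzw two_ne_zero
  have hW_le : W ≤ z 0 ^ 2 - 1 := by nlinarith [hsq, hnorm, sq_nonneg (z 0)]
  have hcauchy : (∑ j : Fin k, z j.succ * w j.succ) ^ 2 ≤ 1 := by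
    calc (∑ j : Fin k, z j.succ * w j.succ) ^ 2 ≤ Z * W := Finset.sum_mul_sq_le_sq_mul_sq _ _ _
      _ ≤ Z * (z 0 ^ 2 - 1) := mul_le_mul_of_nonneg_left hW_le hZ
      _ ≤ 1 := by rwa [mul_comm]
  have hinner : inner ℝ z w = z 0 * w 0 + ∑ j : Fin k, z j.succ * w j.succ := by
    simp [PiLp.inner_apply, Fin.sum_univ_succ, mul_comm]
  linarith [(abs_le.1 ((sq_le_one_iff_abs_le_one _).1 hcauchy)).1]

lemma marginLoss_zero_boxMixture_eq_zero [Finite T] [MeasurableSpace T]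
    [DiscreteMeasurableSpace T] {c : T → Fin (k + 1) → ℝ} {w : EuclideanSpace ℝ (Fin (k + 1))}
    (hw : ‖w‖ ≤ 1) (hcw : ∀ t, 1 < c t 0 * w 0)
    (hc : ∀ t, (c t 0 ^ 2 - 1) * ∑ j : Fin k, c t j.succ ^ 2 ≤ 1) :
    marginLoss 0 (fun x => inner ℝ x w) (boxMixture c) = 0 := by
  refine marginLoss_boxMixture_eq_zero fun ω => ?_
  rw [← real_inner_smul_left]
  refine inner_pos_of_one_lt_mul hw ?_ ?_
  · have hcoord := hcw ω.1
    have hlabel := Label.toReal_mul_self (ω.2 0)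
    simp only [labeledVertex, PiLp.smul_apply, smul_eq_mul]
    linear_combination hcoord + (c ω.1 0 * w 0) * hlabel.symm
  · simpa [labeledVertex, mul_pow, Label.toReal_sq] using hc ω.1

end BoxMargins

section LowerBound

variable {T : Type*} {k m : ℕ}

/-- The half-sides of the box in `ℝ^(k+1)` that has half-side `a` along coordinate `0` and half-side
`b` along all other coordinates. -/
def boxSides (a b : ℝ) : Fin (k + 1) → ℝ :=
  Fin.cons a fun _ => b

lemma eventually_exists_fitsWithMargin (γ : ℝ) {ω : Fin m → T × (Fin (k + 1) → Label)}
    (hω : LinearIndependent ℝ fun i => Label.toReal ∘ relativeSigns (ω i).2) :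
    ∀ᶠ b in atTop, ∀ a, ∃ w : EuclideanSpace ℝ (Fin (k + 1)), ‖w‖ ≤ 1 ∧ w 0 = 0 ∧
      FitsWithMargin γ (fun x => inner ℝ x w)
        (fun i => labeledVertex (fun _ : T => boxSides a b) (ω i)) := by
  obtain ⟨v, hv⟩ := exists_dotProduct_eq_one hω
  let u : EuclideanSpace ℝ (Fin (k + 1)) := WithLp.toLp 2 (Fin.cons 0 v)
  let r := (‖u‖ + 1)⁻¹
  have hr : 0 < r := by positivity
  have hnorm : ‖r • u‖ ≤ 1 := by
    rw [norm_smul, Real.norm_of_nonneg hr.le, inv_mul_le_iff₀ (by positivity), mul_one]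
    exact (lt_add_one _).le
  filter_upwards [eventually_gt_atTop (γ / r)] with b hb a
  refine ⟨r • u, hnorm, mul_zero r, fun i => ?_⟩
  have hsum : ∑ j : Fin k, Label.toReal (relativeSigns (ω i).2 j) * (r • u) j.succ = r := by
    calc _ = r * (v ⬝ᵥ (Label.toReal ∘ relativeSigns (ω i).2)) := by
          rw [dotProduct, Finset.mul_sum]
          refine Finset.sum_congr rfl fun j _ => ?_
          simp only [u, Function.comp_apply, PiLp.smul_apply, Fin.cons_succ, smul_eq_mul]
          ring
      _ = r := by rw [hv i, mul_one]
  simp only [toReal_mul_inner_labeledVertex, boxSides, Fin.cons_zero, Fin.cons_succ, mul_assoc,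
    ← Finset.mul_sum, hsum]
  simpa [u] using (div_lt_iff₀ hr).1 hb

lemma eventually_forall_natCast_le_sampleComplexity_boxMixture (k : ℕ) :
    ∀ᶠ b in atTop, ∀ a ε δ : ℝ, 1 < a → ε < 1 / 2 → 0 ≤ δ → δ < 1 / 2 →
      (k : ℕ∞) ≤ sampleComplexity (linearClass (k + 1)) ε 1
        (boxMixture fun _ : Unit => boxSides a b) δ := by
  have hfit : ∀ᶠ b in atTop, ∀ (m : Fin k) (ω : Fin m → Unit × (Fin (k + 1) → Label)),
      (LinearIndependent ℝ fun i => Label.toReal ∘ relativeSigns (ω i).2) →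
      ∀ a, ∃ w : EuclideanSpace ℝ (Fin (k + 1)), ‖w‖ ≤ 1 ∧ w 0 = 0 ∧
        FitsWithMargin 1 (fun x => inner ℝ x w)
          (fun i => labeledVertex (fun _ : Unit => boxSides a b) (ω i)) :=
    eventually_all.2 fun m => eventually_all.2 fun ω =>
      eventually_imp_distrib_left.2 (eventually_exists_fitsWithMargin 1)
  filter_upwards [hfit] with b hb a ε δ ha hε hδ0 hδ
  set P := boxMixture fun _ : Unit => (boxSides a b : Fin (k + 1) → ℝ)
  have hbest : bestMarginLoss 1 (linearClass (k + 1)) P ≤ 0 :=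
    (bestMarginLoss_le (inner_single_mem_linearClass 0)).trans_eq
      (marginLoss_single_boxMixture fun _ => ha)
  refine le_of_forall_lt fun m hm => ?_
  lift m to ℕ using hm.ne_top
  refine lt_sampleComplexity_of_fitsWithMargin (η := 1 / 2) (linearClass_nonempty _) (by linarith)
    hδ0 (hδ.trans_le ?_)
  rw [pi_boxMixture_real]
  refine (half_le_measure_pi_linearIndependent_relativeSigns (Nat.cast_lt.1 hm)).trans
    (measureReal_mono fun ω hω => ?_)
  obtain ⟨w, hw, hw0, hwfit⟩ := hb ⟨m, Nat.cast_lt.1 hm⟩ ω hω a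
  exact ⟨_, ⟨w, hw, rfl⟩, half_le_marginLoss_boxMixture _ hw0, hwfit⟩

end LowerBound

section UpperBound

variable {k : ℕ}

/-- The half-sides of the two boxes mixed in the easy distribution: the sides other than the first
are stretched by `√2` in one box and collapsed in the other, which leaves the variances of
`boxSides a b` unchanged. -/
def mixtureSides (a b : ℝ) (stretched : Bool) : Fin (k + 1) → ℝ :=
  boxSides a (if stretched then √2 * b else 0)

lemma coordVariance_const {T : Type*} [Fintype T] [Nonempty T] (s : Fin (k + 1) → ℝ) :
    coordVariance (fun _ : T => s) = fun i => s i ^ 2 :=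
  funext fun _ => Fintype.expect_const _

lemma coordVariance_mixtureSides (a b : ℝ) :
    coordVariance (mixtureSides a b : Bool → Fin (k + 1) → ℝ) = fun i => boxSides a b i ^ 2 := by
  funext i
  rw [coordVariance, Fintype.expect_eq_sum_div_card]
  cases i using Fin.cases <;> simp [mixtureSides, boxSides, mul_pow]

lemma mixtureSides_sq_le (a b : ℝ) (t : Bool) (i : Fin (k + 1)) :
    mixtureSides a b t i ^ 2 ≤ 2 * boxSides a b i ^ 2 := by
  cases t <;> cases i using Fin.cases <;> simp [mixtureSides, boxSides, mul_pow] <;> nlinarith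

lemma sampleComplexity_boxMixture_mixtureSides_le {a b ε δ : ℝ} (ha : 1 < a)
    (hab : (a ^ 2 - 1) * (k * (2 * b ^ 2)) ≤ 1) (hε : 0 ≤ ε) (hδ0 : 0 < δ) (hδ1 : δ < 1) :
    sampleComplexity (linearClass (k + 1)) ε 1 (boxMixture (mixtureSides a b)) δ ≤
      (⌈Real.logb 2 (1 / δ)⌉₊ : ℕ) := by
  have hlog : 0 < Real.logb 2 (1 / δ) := Real.logb_pos one_lt_two (one_lt_one_div hδ0 hδ1)
  refine sampleComplexity_le_of_fitsWithMargin (Nat.one_le_ceil_iff.2 hlog) one_pos hε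
    (inner_single_mem_linearClass 0) (marginLoss_single_boxMixture fun _ => ha)
    fun m hm => ?_
  rw [pi_boxMixture_real]
  refine le_trans ?_ (half_pow_le_of_logb_le hδ0 (Nat.ceil_le.1 hm))
  have hall := measure_pi_forall_fst_eq (F := Fin (k + 1) → Label) true m
  rw [Nat.card_eq_fintype_card, Fintype.card_bool, Nat.cast_two] at hall
  rw [← hall]
  refine measureReal_mono ?_
  rintro ω ⟨_, ⟨w, hw, rfl⟩, hloss, hfit⟩ i
  by_contra hcollapsed
  rw [Bool.not_eq_true] at hcollapsed
  have hmargin : 1 < a * w 0 := by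
    have h := hfit i
    simp only [Function.comp_apply, toReal_mul_inner_labeledVertex] at h
    simpa [mixtureSides, boxSides, hcollapsed] using h
  refine hloss.ne' (marginLoss_zero_boxMixture_eq_zero hw (fun _ => hmargin) fun t => ?_)
  cases t
  · simp [mixtureSides, boxSides]
  · simpa [mixtureSides, boxSides, mul_pow] using hab

end UpperBound


theorem mainTheorem8_general (k : ℕ) :
    ∃ D P : Measure (EuclideanSpace ℝ (Fin (k + 1)) × Label),
      IsProbabilityMeasure D ∧ IsProbabilityMeasure P ∧
      covarianceMatrix D.fst = covarianceMatrix P.fst ∧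
      (∃ B, IsSubGaussianVector D.fst B) ∧ (∃ B, IsSubGaussianVector P.fst B) ∧
      (∀ u : EuclideanSpace ℝ (Fin (k + 1)),
        HasRelativeMoment D.fst (fun x => inner ℝ u x) √2) ∧
      (∀ u : EuclideanSpace ℝ (Fin (k + 1)),
        HasRelativeMoment P.fst (fun x => inner ℝ u x) √2) ∧
      (∀ ε δ : ℝ, ε < 1 / 2 → 0 ≤ δ → δ < 1 / 2 →
        (k : ℕ∞) ≤ sampleComplexity (linearClass (k + 1)) ε 1 P δ) ∧
      (∀ ε δ : ℝ, 0 ≤ ε → 0 < δ → δ < 1 →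
        sampleComplexity (linearClass (k + 1)) ε 1 D δ ≤ (⌈Real.logb 2 (1 / δ)⌉₊ : ℕ)) := by
  obtain ⟨b, hb⟩ := (eventually_forall_natCast_le_sampleComplexity_boxMixture k).exists
  obtain ⟨a, ha, hab⟩ := exists_one_lt_sq_sub_one_mul_le (K := k * (2 * b ^ 2)) (by positivity)
  have hsq : √2 ^ 2 = (2 : ℝ) := Real.sq_sqrt zero_le_two
  have hconst (i : Fin (k + 1)) : boxSides a b i ^ 2 ≤ 2 * boxSides a b i ^ 2 := by
    linarith [sq_nonneg (boxSides a b i)]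
  refine ⟨boxMixture (mixtureSides a b), boxMixture fun _ : Unit => boxSides a b,
    inferInstance, inferInstance, ?_,
    ⟨_, isSubGaussianVector_boxMixture_fst (mixtureSides_sq_le a b)⟩,
    ⟨_, isSubGaussianVector_boxMixture_fst fun _ => hconst⟩,
    hasRelativeMoment_boxMixture_fst (by positivity) ?_,
    hasRelativeMoment_boxMixture_fst (by positivity) ?_,
    fun ε δ => hb a ε δ ha, fun ε δ => sampleComplexity_boxMixture_mixtureSides_le ha hab⟩
  · simp only [covarianceMatrix_boxMixture_fst, coordVariance_mixtureSides, coordVariance_const]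
  · simpa only [coordVariance_mixtureSides, hsq] using mixtureSides_sq_le a b
  · simpa only [coordVariance_const, hsq] using fun _ => hconst

end MarginLearning

end

theorem mainTheorem8 :
    ∃ β C : ℝ, 0 < β ∧ 0 ≤ C ∧
      ∀ d : ℕ, 1 < d →
        ∃ D P : Measure (EuclideanSpace ℝ (Fin d) × MarginLearning.Label),
          IsProbabilityMeasure D ∧ IsProbabilityMeasure P ∧
          MarginLearning.covarianceMatrix D.fst = MarginLearning.covarianceMatrix P.fst ∧
          (∃ B, MarginLearning.IsSubGaussianVector D.fst B) ∧
          (∃ B, MarginLearning.IsSubGaussianVector P.fst B) ∧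
          (∀ u : EuclideanSpace ℝ (Fin d),
            MarginLearning.HasRelativeMoment D.fst (fun x => inner ℝ u x) (Real.sqrt 2)) ∧
          (∀ u : EuclideanSpace ℝ (Fin d),
            MarginLearning.HasRelativeMoment P.fst (fun x => inner ℝ u x) (Real.sqrt 2)) ∧
          ∀ ε δ : ℝ, 0 < ε → ε < 1 / 4 → 0 < δ → δ < 1 / 4 →
            ENNReal.ofReal (β * (d : ℝ) - C) ≤
              ((MarginLearning.sampleComplexity
                (MarginLearning.linearClass d) ε 1 P δ : ℕ∞) : ℝ≥0∞) ∧
            MarginLearning.sampleComplexity (MarginLearning.linearClass d) ε 1 D δ ≤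
              ((⌈Real.logb 2 (1 / δ)⌉₊ : ℕ) : ℕ∞) := by
  refine ⟨1, 1, one_pos, zero_le_one, fun d hd => ?_⟩
  obtain ⟨k, rfl⟩ := Nat.exists_eq_add_one.2 (zero_lt_one.trans hd)
  obtain ⟨D, P, hD, hP, hcov, hDvec, hPvec, hDrel, hPrel, hlower, hupper⟩ :=
    MarginLearning.mainTheorem8_general k
  refine ⟨D, P, hD, hP, hcov, hDvec, hPvec, hDrel, hPrel, fun ε δ hε0 hε hδ0 hδ =>
    ⟨?_, hupper ε δ hε0.le hδ0 (by linarith)⟩⟩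
  simpa using ENat.toENNReal_le.2 (hlower ε δ (by linarith) hδ0.le (by linarith))
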